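/- Conventions. All Hilbert spaces are complex, with inner products $(\cdot,\cdot)$ linear in the first entry; $\mathcal B(\mathcal G)$ denotes the bounded everywhere defined operators on $\mathcal G$ and $D(z_0;\varepsilon)$ the open disc. For a closed operator $T$, $z\in\rho(T)$ means that $T-zI$ is bijective from $\mathrm{dom}(T)$ onto the whole space with bounded inverse. The discrete spectrum $\sigma_d(T)$ consists of the eigenvalues $z_0$ of $T$ that are isolated in the spectrum $\sigma(T)=\mathbb C\setminus\rho(T)$ and have finite algebraic multiplicity, i.e. the Riesz projection $P(z_0;T)=-\frac1{2\pi i}\oint_{|\zeta-z_0|=r}(T-\zeta I)^{-1}\,d\zeta$ ($r>0$ small) has finite rank. A $\mathcal B(\mathcal G)$-valued function $F$ is finitely meromorphic at $w$ if on some punctured disc around $w$ it has a norm convergent Laurent expansion $F(z)=\sum_{k=-N}^{\infty}(z-w)^kF_k$ with $N\in\mathbb N_0$, $F_k\in\mathcal B(\mathcal G)$, and $F_k$ of finite rank for $-N\le k\le -1$; it is finitely meromorphic on an open set $\Omega$ if it is meromorphic on $\Omega$ and finitely meromorphic at each of its poles in $\Omega$. Setting. Let $\mathfrak H$ be a separable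 complex Hilbert space and let $B_1,B_2$ be densely defined closed operators in $\mathfrak H$ with $\rho(B_1)\cap\rho(B_2)\neq\emptyset$. Let $S=B_1\cap B_2$ be their common restriction to $\{f\in\mathrm{dom}(B_1)\cap\mathrm{dom}(B_2) : B_1f=B_2f\}$, and assume that $S$ is densely defined and symmetric with equal deficiency indices. Let $A_0$ be a self-adjoint extension of $S$ such that $$S=A_0\cap B_1=A_0\cap B_2=A_0\cap B_1^*=A_0\cap B_2^*.$$ Let $\{\mathcal G,\Gamma_0,\Gamma_1\}$ be a boundary triple for $S^*$, that is, $\mathcal G$ is a Hilbert space and $\Gamma_0,\Gamma_1:\mathrm{dom}(S^*)\to\mathcal G$ are linear maps such that $(S^*f,g)-(f,S^*g)=(\Gamma_1f,\Gamma_0g)-(\Gamma_0f,\Gamma_1g)$ for all $f,g\in\mathrm{dom}(S^*)$ and $f\mapsto(\Gamma_0f,\Gamma_1f)$ maps $\mathrm{dom}(S^*)$ onto $\mathcal G\times\mathcal G$. Let $\Theta_1,\Theta_2$ be densely defined closed operators in $\mathcal G$, and assume that $A_0=S^*\upharpoonright\ker(\Gamma_0)$ and $$B_j=S^*\upharpoonright\ker(\Gamma_1-\Theta_j\Gamma_0),\qquad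 B_j^*=S^*\upharpoonright\ker(\Gamma_1-\Theta_j^*\Gamma_0),\qquad j=1,2.$$ Let $M(z)=\Gamma_1\bigl(\Gamma_0\upharpoonright\ker(S^*-zI)\bigr)^{-1}$, $z\in\rho(A_0)$, be the corresponding Weyl--Titchmarsh function. Proposition. Assume that $z_0\in\sigma_d(B_j)\cup\rho(B_j)$ for $j=1,2$ and $z_0\in\sigma_d(A_0)\cup\rho(A_0)$. Then there exists $\varepsilon_0>0$ such that $D(z_0;\varepsilon_0)\setminus\{z_0\}\subset\rho(A_0)$ and, for $j=1,2$, the operator $\Theta_j-M(z)$ has an inverse $(\Theta_j-M(z))^{-1}\in\mathcal B(\mathcal G)$ for every $z\in D(z_0;\varepsilon_0)\setminus\{z_0\}$, and the function $$z\mapsto\bigl(\Theta_j-M(z)\bigr)^{-1}\in\mathcal B(\mathcal G)$$ is analytic on $D(z_0;\varepsilon_0)\setminus\{z_0\}$ and finitely meromorphic on $D(z_0;\varepsilon_0)$. -/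

import Mathlib

open scoped Topology

noncomputable section

namespace WeylExt

/-! ### Closed operators: bounded inverses, resolvent set, discrete spectrum -/

section Operators

variable {E : Type*} [NormedAddCommGroup E] [InnerProductSpace ℂ E]

/-- The everywhere defined operator `z I`, as a partially defined operator. -/
def scalarOp (E : Type*) [NormedAddCommGroup E] [InnerProductSpace ℂ E] (z : ℂ) : E →ₗ.[ℂ] E :=
  (z • (LinearMap.id : E →ₗ[ℂ] E)).toPMap ⊤

/-- `R` is the inverse of the (possibly unbounded) operator `T`, and `R` is bounded and everywhere
defined: the graph of `T` is `{(R y, y)}`. -/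
def IsBoundedInverse (T : E →ₗ.[ℂ] E) (R : E →L[ℂ] E) : Prop :=
  ∀ x y : E, (x, y) ∈ T.graph ↔ R y = x

/-- `T` is injective and onto, with an inverse in `𝓑(E)`. -/
def BoundedlyInvertible (T : E →ₗ.[ℂ] E) : Prop :=
  ∃ R : E →L[ℂ] E, IsBoundedInverse T R

open scoped Classical in
/-- The inverse of a boundedly invertible operator as an element of `𝓑(E)`
(and `0` if `T` is not boundedly invertible). -/
def boundedInverse (T : E →ₗ.[ℂ] E) : E →L[ℂ] E :=
  if h : BoundedlyInvertible T then h.choose else 0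

/-- The resolvent set `ρ(T)`. -/
def resolventSet (T : E →ₗ.[ℂ] E) : Set ℂ :=
  {z | BoundedlyInvertible (T - scalarOp E z)}

/-- The resolvent `(T - z I)⁻¹ ∈ 𝓑(E)`, for `z ∈ ρ(T)`. -/
def resolvent (T : E →ₗ.[ℂ] E) (z : ℂ) : E →L[ℂ] E :=
  boundedInverse (T - scalarOp E z)

/-- The Riesz projection `-(2πi)⁻¹ ∮ (T - ζ I)⁻¹ dζ`, the integral being over the counterclockwise
circle with centre `z₀` and radius `r`. -/
def rieszProjection (T : E →ₗ.[ℂ] E) (z₀ : ℂ) (r : ℝ) : E →L[ℂ] E :=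
  -((2 * (Real.pi : ℂ) * Complex.I)⁻¹ • ∮ ζ in C(z₀, r), resolvent T ζ)

/-- Bounded operators of finite rank. -/
def IsFiniteRank (R : E →L[ℂ] E) : Prop :=
  FiniteDimensional ℂ (LinearMap.range (R : E →ₗ[ℂ] E))

/-- The discrete spectrum `σ_d(T)`: eigenvalues which are isolated in the spectrum and have
finite algebraic multiplicity, the algebraic eigenspace at an isolated point `z₀` of the spectrum
being the range of the Riesz projection for a circle around `z₀` that encloses no other point of
the spectrum. -/
def discreteSpectrum (T : E →ₗ.[ℂ] E) : Set ℂ :=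
  {z₀ | (∃ x : T.domain, (x : E) ≠ 0 ∧ T x = z₀ • (x : E)) ∧
    ∃ r : ℝ, 0 < r ∧ Metric.closedBall z₀ r \ {z₀} ⊆ resolventSet T ∧
      IsFiniteRank (rieszProjection T z₀ r)}

end Operators

/-! ### Finitely meromorphic operator-valued functions -/

section Meromorphic

variable {E : Type*} [NormedAddCommGroup E] [InnerProductSpace ℂ E]

/-- `F` is finitely meromorphic at `z₀`: on a punctured disc it is the sum of a norm convergent
Laurent series `F z = ∑_{k ≥ -N} (z - z₀)^k F_k` whose coefficients `F_k` with `-N ≤ k ≤ -1` have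
finite rank. Here `C n` is the coefficient `F_{n - N}`. -/
def FinitelyMeromorphicAt (F : ℂ → E →L[ℂ] E) (z₀ : ℂ) : Prop :=
  ∃ ε : ℝ, 0 < ε ∧ ∃ (N : ℕ) (C : ℕ → E →L[ℂ] E),
    (∀ n < N, IsFiniteRank (C n)) ∧
    ∀ z ∈ Metric.ball z₀ ε \ {z₀}, HasSum (fun n : ℕ => (z - z₀) ^ ((n : ℤ) - (N : ℤ)) • C n) (F z)

/-- `F` is finitely meromorphic on `Ω`: it is meromorphic on `Ω` and finitely meromorphic at each
of its poles in `Ω`. -/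
def FinitelyMeromorphicOn (F : ℂ → E →L[ℂ] E) (Ω : Set ℂ) : Prop :=
  MeromorphicOn F Ω ∧ ∀ w ∈ Ω, meromorphicOrderAt F w < 0 → FinitelyMeromorphicAt F w

end Meromorphic

/-! ### Boundary triples and Weyl--Titchmarsh functions -/

section Triples

open scoped LinearPMap

variable {H : Type*} [NormedAddCommGroup H] [InnerProductSpace ℂ H]

/-- The restriction `T ↾ N` of `T` to a subspace `N` of its domain. -/
def restrict (T : H →ₗ.[ℂ] H) (N : Submodule ℂ T.domain) : H →ₗ.[ℂ] H :=
  T.domRestrict (N.map T.domain.subtype)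

/-- `ker (T - z I)`, as a subspace of the domain of `T`. -/
def eigenKer (T : H →ₗ.[ℂ] H) (z : ℂ) : Submodule ℂ T.domain :=
  LinearMap.ker (T.toFun - z • T.domain.subtype)

variable [CompleteSpace H]

/-- A boundary triple `{G, Γ₀, Γ₁}` for `S*`. (The inner product of Mathlib is linear in the second
entry.) -/
structure BoundaryTriple (S : H →ₗ.[ℂ] H) (G : Type*) [NormedAddCommGroup G]
    [InnerProductSpace ℂ G] where
  Γ₀ : S†.domain →ₗ[ℂ] G
  Γ₁ : S†.domain →ₗ[ℂ] G
  green : ∀ f g : S†.domain,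
    inner ℂ (g : H) (S† f) - inner ℂ (S† g) (f : H)
      = inner ℂ (Γ₀ g) (Γ₁ f) - inner ℂ (Γ₁ g) (Γ₀ f)
  surjective : Function.Surjective fun f : S†.domain => (Γ₀ f, Γ₁ f)

namespace BoundaryTriple

variable {S : H →ₗ.[ℂ] H} {G : Type*} [NormedAddCommGroup G] [InnerProductSpace ℂ G]

/-- `S* ↾ ker Γ₀`. -/
def baseExtension (bt : BoundaryTriple S G) : H →ₗ.[ℂ] H :=
  restrict S† (LinearMap.ker bt.Γ₀)

/-- `S* ↾ ker (Γ₁ - Θ Γ₀)`: the domain consists of the `f ∈ dom S*` with `Γ₀ f ∈ dom Θ` and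
`Θ Γ₀ f = Γ₁ f`. -/
def extension (bt : BoundaryTriple S G) (Θ : G →ₗ.[ℂ] G) : H →ₗ.[ℂ] H :=
  restrict S† (Θ.graph.comap (bt.Γ₀.prod bt.Γ₁))

/-- The `γ`-field `γ(z) = (Γ₀ ↾ ker (S* - z I))⁻¹`, with values in `dom S*`. -/
def gammaField (bt : BoundaryTriple S G) (z : ℂ) : G →ₗ.[ℂ] S†.domain :=
  (bt.Γ₀.toPMap (eigenKer S† z)).inverse

/-- The Weyl--Titchmarsh function `M(z) = Γ₁ (Γ₀ ↾ ker (S* - z I))⁻¹`. For `z` in the resolvent set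
of `S* ↾ ker Γ₀`, the inverse exists and `M(z)` is defined on all of `G`. -/
def weylM (bt : BoundaryTriple S G) (z : ℂ) : G →ₗ.[ℂ] G :=
  bt.Γ₁.compPMap (bt.gammaField z)

end BoundaryTriple

/-- The standing assumptions on the closed operators `B 0`, `B 1`, on their intersection
`S = B 0 ∩ B 1` (the common restriction of both operators to
`{f ∈ dom (B 0) ∩ dom (B 1) | B 0 f = B 1 f}`), and on the self-adjoint operator `A₀`. -/
structure Setting (B : Fin 2 → H →ₗ.[ℂ] H) (S A₀ : H →ₗ.[ℂ] H) : Prop where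
  dense_B : ∀ j, Dense ((B j).domain : Set H)
  closed_B : ∀ j, (B j).IsClosed
  nonempty_resolventSet : (resolventSet (B 0) ∩ resolventSet (B 1)).Nonempty
  S_eq : S = B 0 ⊓ B 1
  dense_S : Dense (S.domain : Set H)
  symmetric_S : S.IsFormalAdjoint S
  /-- Equal deficiency indices: `ker (S* - i)` and `ker (S* + i)` have equal Hilbert dimension. -/
  deficiency : Nonempty
    ((eigenKer S† Complex.I).map S†.domain.subtype ≃ₗᵢ[ℂ]
      (eigenKer S† (-Complex.I)).map S†.domain.subtype)
  selfAdjoint : IsSelfAdjoint A₀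
  extends_S : S ≤ A₀
  disjoint_B : ∀ j, A₀ ⊓ B j = S
  disjoint_B_adjoint : ∀ j, A₀ ⊓ (B j)† = S

end Triples

end WeylExt

end

/-!
Let `R` be the resolvent of `T` and `P` its Riesz projection at an isolated point `z₀` of the
spectrum. Integrating `R(z) / (ζ - z) = R(ζ) / (ζ - z) - R(ζ) R(z)` over a circle splits `R(z)` into
a Cauchy integral, analytic at `z₀`, and `P R(z)`. If `P` has finite rank, `T` restricts to an
endomorphism `D` of the invariant subspace `ran P`, where `R(z)` is `(D - z)⁻¹`: this is a rational
function of `z`, as `D` is algebraic. So the polar part of `R` has finite rank.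

To solve `(Θ - M(z)) x = y`, choose `e ∈ ker Γ₀` with `Γ₁ e = y`. The vectors of `dom S†` with the
same image under `S† - z` as `e` are the `e + g` with `g ∈ ker (S† - z)`, and `e + g` lies in the
domain of the extension `B` given by `Θ` if and only if `x = Γ₀ g` is the solution; thus
`(Θ - M(z))⁻¹ y = Γ₀ (B - z)⁻¹ (S† - z) e`. Here `e` and `S† e` can be chosen to depend boundedly on
`y`, and `Γ₀ (B - z)⁻¹ = Γ₀ (B - w)⁻¹ (1 + (z - w) (B - z)⁻¹)` for a fixed `w`, so the polar part of
`(Θ - M(z))⁻¹` is obtained from that of `(B - z)⁻¹` by composition with fixed bounded operators and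
polynomials in `z`.
-/

open Filter
open scoped Topology LinearPMap

namespace WeylExt

section Resolvent

variable {E : Type*} [NormedAddCommGroup E] [InnerProductSpace ℂ E] {T : E →ₗ.[ℂ] E} {z w : ℂ}

theorem mem_graph_sub_iff {R X Y : Type*} [Ring R] [AddCommGroup X] [Module R X] [AddCommGroup Y]
    [Module R Y] {T U : X →ₗ.[R] Y} {x : X} {y : Y} :
    (x, y) ∈ (T - U).graph ↔ ∃ a b, (x, a) ∈ T.graph ∧ (x, b) ∈ U.graph ∧ a - b = y := by
  constructor
  · intro h
    obtain ⟨⟨x', hx'⟩, rfl, h2⟩ := (LinearPMap.mem_graph_iff _).1 h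
    exact ⟨_, _, T.mem_graph ⟨x', hx'.1⟩, U.mem_graph ⟨x', hx'.2⟩, h2⟩
  · rintro ⟨a, b, ha, hb, rfl⟩
    obtain ⟨⟨x₁, hx₁⟩, rfl, rfl⟩ := (LinearPMap.mem_graph_iff _).1 ha
    obtain ⟨⟨x₂, hx₂⟩, rfl, rfl⟩ := (LinearPMap.mem_graph_iff _).1 hb
    exact (T - U).mem_graph ⟨x₂, hx₁, hx₂⟩

theorem mem_graph_sub_scalarOp {x y : E} :
    (x, y) ∈ (T - scalarOp E z).graph ↔ (x, y + z • x) ∈ T.graph := by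
  rw [mem_graph_sub_iff]
  constructor
  · rintro ⟨a, b, ha, hb, rfl⟩
    obtain ⟨x', rfl, rfl⟩ := (LinearPMap.mem_graph_iff _).1 hb
    have hval : scalarOp E z x' = z • (x' : E) := rfl
    rwa [hval, sub_add_cancel]
  · intro h
    exact ⟨_, z • x, h, (scalarOp E z).mem_graph ⟨x, Submodule.mem_top⟩, add_sub_cancel_right _ _⟩

theorem IsBoundedInverse.boundedInverse_eq {R : E →L[ℂ] E} (h : IsBoundedInverse T R) :
    boundedInverse T = R := by
  have hT : BoundedlyInvertible T := ⟨R, h⟩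
  have h' : IsBoundedInverse T (boundedInverse T) := by
    rw [boundedInverse, dif_pos hT]
    exact hT.choose_spec
  ext y
  exact ((h _ y).1 ((h' _ y).2 rfl)).symm

theorem resolvent_apply_eq_iff (hz : z ∈ resolventSet T) {x y : E} :
    resolvent T z y = x ↔ (x, y + z • x) ∈ T.graph := by
  obtain ⟨R, hR⟩ := hz
  rw [resolvent, hR.boundedInverse_eq, ← mem_graph_sub_scalarOp]
  exact (hR x y).symm

theorem resolvent_mem_graph (hz : z ∈ resolventSet T) (y : E) :
    (resolvent T z y, y + z • resolvent T z y) ∈ T.graph :=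
  (resolvent_apply_eq_iff hz).1 rfl

theorem resolvent_apply_add_smul (hz : z ∈ resolventSet T) (hw : w ∈ resolventSet T) (y : E) :
    resolvent T w (y + (z - w) • resolvent T z y) = resolvent T z y := by
  rw [resolvent_apply_eq_iff hw]
  convert! resolvent_mem_graph hz y using 2
  module

theorem resolvent_sub_resolvent (hz : z ∈ resolventSet T) (hw : w ∈ resolventSet T) :
    resolvent T z - resolvent T w = (z - w) • (resolvent T w * resolvent T z) := by
  ext y
  rw [sub_apply, sub_eq_iff_eq_add', ← resolvent_apply_add_smul hz hw y]
  simp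

theorem commute_resolvent (hz : z ∈ resolventSet T) (hw : w ∈ resolventSet T) :
    Commute (resolvent T z) (resolvent T w) := by
  rcases eq_or_ne z w with rfl | hne
  · exact Commute.refl _
  refine smul_right_injective _ (sub_ne_zero.2 hne) ?_
  calc (z - w) • (resolvent T z * resolvent T w)
      = -(resolvent T w - resolvent T z) := by
        rw [resolvent_sub_resolvent hw hz, ← neg_smul, neg_sub]
    _ = (z - w) • (resolvent T w * resolvent T z) := by
        rw [neg_sub, resolvent_sub_resolvent hz hw]

theorem inv_sub_smul_resolvent {ζ : ℂ} (hz : z ∈ resolventSet T) (hζ : ζ ∈ resolventSet T)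
    (hne : ζ ≠ z) :
    (ζ - z)⁻¹ • resolvent T z = (ζ - z)⁻¹ • resolvent T ζ - resolvent T ζ * resolvent T z := by
  rw [eq_sub_iff_add_eq', ← eq_sub_iff_add_eq, ← smul_sub, resolvent_sub_resolvent hζ hz,
    inv_smul_smul₀ (sub_ne_zero.2 hne), (commute_resolvent hζ hz).eq]

theorem isBoundedInverse_sub_scalarOp (hw : w ∈ resolventSet T) (u : (E →L[ℂ] E)ˣ)
    (hu : (u : E →L[ℂ] E) = 1 - (z - w) • resolvent T w) :
    IsBoundedInverse (T - scalarOp E z) (↑u⁻¹ * resolvent T w) := by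
  intro x y
  have hux : resolvent T w (y + (z - w) • x) = x ↔ (u : E →L[ℂ] E) x = resolvent T w y := by
    rw [hu, map_add, map_smul, eq_comm, ← sub_eq_iff_eq_add]
    rfl
  calc (x, y) ∈ (T - scalarOp E z).graph
      ↔ (x, y + (z - w) • x + w • x) ∈ T.graph := by
        rw [mem_graph_sub_scalarOp, add_assoc, ← add_smul, sub_add_cancel]
    _ ↔ (u : E →L[ℂ] E) x = resolvent T w y := by rw [← resolvent_apply_eq_iff hw, hux]
    _ ↔ (↑u⁻¹ * resolvent T w) y = x :=
        eq_comm.trans (ContinuousLinearEquiv.ofUnit u).symm_apply_eq.symm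

variable [CompleteSpace E]

theorem eventually_isBoundedInverse_sub_scalarOp (hw : w ∈ resolventSet T) :
    ∀ᶠ z in 𝓝 w, IsBoundedInverse (T - scalarOp E z)
      (Ring.inverse (1 - (z - w) • resolvent T w) * resolvent T w) := by
  have htendsto : Tendsto (fun z : ℂ => 1 - (z - w) • resolvent T w) (𝓝 w) (𝓝 1) := by
    have : Continuous fun z : ℂ => 1 - (z - w) • resolvent T w := by fun_prop
    simpa using this.tendsto w
  filter_upwards [htendsto (Units.isOpen.mem_nhds isUnit_one)] with z ⟨u, hu⟩
  beta_reduce at hu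
  rw [← hu, Ring.inverse_unit]
  exact isBoundedInverse_sub_scalarOp hw u hu

theorem isOpen_resolventSet (T : E →ₗ.[ℂ] E) : IsOpen (resolventSet T) :=
  isOpen_iff_eventually.2 fun _ hw =>
    (eventually_isBoundedInverse_sub_scalarOp hw).mono fun _ hz => ⟨_, hz⟩

theorem analyticAt_resolvent (hw : w ∈ resolventSet T) : AnalyticAt ℂ (resolvent T) w := by
  have hinv : AnalyticAt ℂ (fun z => Ring.inverse (1 - (z - w) • resolvent T w)) w := by
    refine AnalyticAt.fun_comp (g := Ring.inverse) ?_ (by fun_prop)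
    simpa using analyticAt_inverse (𝕜 := ℂ) (1 : (E →L[ℂ] E)ˣ)
  refine (hinv.mul (analyticAt_const (v := resolvent T w))).congr ?_
  filter_upwards [eventually_isBoundedInverse_sub_scalarOp hw] with z hz
  exact hz.boundedInverse_eq.symm

theorem eventually_mem_resolventSet {z₀ : ℂ}
    (hz₀ : z₀ ∈ discreteSpectrum T ∪ resolventSet T) : ∀ᶠ z in 𝓝[≠] z₀, z ∈ resolventSet T := by
  rcases hz₀ with ⟨-, r, hr, hT, -⟩ | hz₀
  · filter_upwards [nhdsWithin_le_nhds (Metric.closedBall_mem_nhds z₀ hr),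
      self_mem_nhdsWithin] with z h1 h2 using hT ⟨h1, h2⟩
  · exact nhdsWithin_le_nhds ((isOpen_resolventSet T).mem_nhds hz₀)

end Resolvent

section CircleIntegral

variable {A : Type*} [NormedRing A] [NormedAlgebra ℂ A] [CompleteSpace A] {f : ℂ → A} {c : ℂ}
  {r : ℝ}

theorem circleIntegral_mul_const (hf : CircleIntegrable f c r) (a : A) :
    (∮ z in C(c, r), f z * a) = (∮ z in C(c, r), f z) * a := by
  have h := ((ContinuousLinearMap.mul ℂ A).flip a).intervalIntegral_comp_comm hf.out
  simpa only [circleIntegral, ContinuousLinearMap.flip_apply, ContinuousLinearMap.mul_apply',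
    smul_mul_assoc] using h

theorem circleIntegral_const_mul (hf : CircleIntegrable f c r) (a : A) :
    (∮ z in C(c, r), a * f z) = a * ∮ z in C(c, r), f z := by
  have h := (ContinuousLinearMap.mul ℂ A a).intervalIntegral_comp_comm hf.out
  simpa only [circleIntegral, ContinuousLinearMap.mul_apply', mul_smul_comm] using h

theorem commute_circleIntegral (hr : 0 ≤ r) (hf : CircleIntegrable f c r) {a : A}
    (ha : ∀ z ∈ Metric.sphere c r, Commute (f z) a) : Commute (∮ z in C(c, r), f z) a := by
  rw [Commute, SemiconjBy, ← circleIntegral_mul_const hf, ← circleIntegral_const_mul hf]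
  exact circleIntegral.integral_congr hr ha

end CircleIntegral

section RieszProjection

variable {E : Type*} [NormedAddCommGroup E] [InnerProductSpace ℂ E] [CompleteSpace E]
  {T : E →ₗ.[ℂ] E} {z z₀ : ℂ} {r : ℝ}

theorem sphere_subset_closedBall_sdiff_center (hr : 0 < r) :
    Metric.sphere z₀ r ⊆ Metric.closedBall z₀ r \ {z₀} :=
  fun _ hζ => ⟨Metric.sphere_subset_closedBall hζ, Metric.ne_of_mem_sphere hζ hr.ne'⟩

theorem continuousOn_resolvent_sphere (hT : Metric.sphere z₀ r ⊆ resolventSet T) :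
    ContinuousOn (resolvent T) (Metric.sphere z₀ r) :=
  fun _ hζ => (analyticAt_resolvent (hT hζ)).continuousAt.continuousWithinAt

theorem commute_rieszProjection_resolvent (hr : 0 ≤ r)
    (hT : Metric.sphere z₀ r ⊆ resolventSet T) (hz : z ∈ resolventSet T) :
    Commute (rieszProjection T z₀ r) (resolvent T z) := by
  have hi := (continuousOn_resolvent_sphere hT).circleIntegrable hr
  have h := commute_circleIntegral hr hi fun ζ hζ => commute_resolvent (hT hζ) hz
  exact (h.smul_left _).neg_left

theorem resolvent_eq_cauchy_add_riesz (hT : Metric.sphere z₀ r ⊆ resolventSet T)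
    (hzr : z ∈ Metric.ball z₀ r) (hz : z ∈ resolventSet T) :
    resolvent T z = (2 * (Real.pi : ℂ) * Complex.I)⁻¹ •
        (∮ ζ in C(z₀, r), (ζ - z)⁻¹ • resolvent T ζ) + rieszProjection T z₀ r * resolvent T z := by
  have hr : 0 ≤ r := (Metric.pos_of_mem_ball hzr).le
  have hne : ∀ ζ ∈ Metric.sphere z₀ r, ζ ≠ z :=
    fun ζ hζ h => (Metric.mem_ball.1 hzr).ne (h ▸ Metric.mem_sphere.1 hζ)
  have hR := continuousOn_resolvent_sphere hT
  have hcauchy : CircleIntegrable (fun ζ => (ζ - z)⁻¹ • resolvent T ζ) z₀ r :=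
    ContinuousOn.circleIntegrable hr <| ContinuousOn.smul
      ((continuousOn_id.sub continuousOn_const).inv₀ fun ζ hζ => sub_ne_zero.2 (hne ζ hζ)) hR
  have hproduct : CircleIntegrable (fun ζ => resolvent T ζ * resolvent T z) z₀ r :=
    (hR.mul continuousOn_const).circleIntegrable hr
  have key : (2 * (Real.pi : ℂ) * Complex.I) • resolvent T z =
      (∮ ζ in C(z₀, r), (ζ - z)⁻¹ • resolvent T ζ) -
        (∮ ζ in C(z₀, r), resolvent T ζ) * resolvent T z :=
    calc (2 * (Real.pi : ℂ) * Complex.I) • resolvent T z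
        = ∮ ζ in C(z₀, r), (ζ - z)⁻¹ • resolvent T z := by
          rw [circleIntegral.integral_smul_const, circleIntegral.integral_sub_inv_of_mem_ball hzr]
      _ = ∮ ζ in C(z₀, r), ((ζ - z)⁻¹ • resolvent T ζ - resolvent T ζ * resolvent T z) :=
          circleIntegral.integral_congr hr fun ζ hζ =>
            inv_sub_smul_resolvent hz (hT hζ) (hne ζ hζ)
      _ = _ := by
          rw [circleIntegral.integral_sub hcauchy hproduct,
            circleIntegral_mul_const (hR.circleIntegrable hr)]
  rw [rieszProjection, neg_mul, smul_mul_assoc, ← sub_eq_add_neg, ← smul_sub, ← key,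
    inv_smul_smul₀ Complex.two_pi_I_ne_zero]

end RieszProjection

section InvariantSubspace

variable {E : Type*} [NormedAddCommGroup E] [InnerProductSpace ℂ E] {T : E →ₗ.[ℂ] E} {z w : ℂ}
  {V : Submodule ℂ E} [FiniteDimensional ℂ V]

theorem exists_forall_mem_graph_of_mapsTo_resolvent (hw : w ∈ resolventSet T)
    (hV : ∀ x ∈ V, resolvent T w x ∈ V) :
    ∃ D : V →L[ℂ] V, ∀ x : V, ((x : E), (D x : E)) ∈ T.graph := by
  let R : V →ₗ[ℂ] V := (resolvent T w : E →ₗ[ℂ] E).restrict hV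
  have hR : Function.Injective R := (injective_iff_map_eq_zero R).2 fun x hx => by
    have hx0 : (0, (x : E) + w • (0 : E)) ∈ T.graph :=
      (resolvent_apply_eq_iff hw).1 (congrArg Subtype.val hx)
    simpa using T.graph_fst_eq_zero_snd hx0 rfl
  let L := (LinearEquiv.ofInjectiveEndo R hR).symm
  refine ⟨LinearMap.toContinuousLinearMap ((L : V →ₗ[ℂ] V) + w • LinearMap.id), fun x => ?_⟩
  have hx : resolvent T w (L x) = x :=
    congrArg Subtype.val ((LinearEquiv.ofInjectiveEndo R hR).apply_symm_apply x)
  exact (resolvent_apply_eq_iff hw).1 hx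

theorem resolvent_comp_subtypeL {D : V →L[ℂ] V} (hD : ∀ x : V, ((x : E), (D x : E)) ∈ T.graph)
    (hz : z ∈ resolventSet T) :
    resolvent T z ∘L V.subtypeL =
      V.subtypeL ∘L Ring.inverse (D - algebraMap ℂ (V →L[ℂ] V) z) := by
  set B := D - algebraMap ℂ (V →L[ℂ] V) z with hB
  have hRB : ∀ x : V, resolvent T z (B x) = x := fun x => by
    rw [resolvent_apply_eq_iff hz]
    convert! hD x using 2
    simp [hB, Algebra.algebraMap_eq_smul_one]
  have hinj : Function.Injective (B : V →ₗ[ℂ] V) := fun x y hxy => Subtype.ext <| by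
    rw [← hRB x, ← hRB y]
    exact congrArg (fun v : V => resolvent T z v) hxy
  have hB_unit : IsUnit B := ContinuousLinearMap.isUnit_iff_bijective.2
    ⟨hinj, LinearMap.injective_iff_surjective.1 hinj⟩
  ext x
  calc resolvent T z x = resolvent T z ((B * Ring.inverse B) x : V) := by
        rw [Ring.mul_inverse_cancel B hB_unit, one_apply_eq_self]
    _ = (Ring.inverse B x : V) := hRB _

end InvariantSubspace

section Meromorphic

variable {X Y Z : Type*} [NormedAddCommGroup X] [NormedSpace ℂ X] [NormedAddCommGroup Y]
  [NormedSpace ℂ Y] [NormedAddCommGroup Z] [NormedSpace ℂ Z]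

theorem analyticAt_clm_comp {f : ℂ → Y →L[ℂ] Z} {g : ℂ → X →L[ℂ] Y} {z : ℂ}
    (hf : AnalyticAt ℂ f z) (hg : AnalyticAt ℂ g z) : AnalyticAt ℂ (fun z => f z ∘L g z) z :=
  ((ContinuousLinearMap.compL ℂ X Y Z).analyticAt_bilinear (f z, g z)).fun_comp
    (f := fun z => (f z, g z)) (hf.prod hg)

theorem meromorphicAt_clm_comp {f : ℂ → Y →L[ℂ] Z} {g : ℂ → X →L[ℂ] Y} {z : ℂ}
    (hf : MeromorphicAt f z) (hg : MeromorphicAt g z) :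
    MeromorphicAt (fun z => f z ∘L g z) z := by
  obtain ⟨k, hk⟩ := hf
  obtain ⟨n, hn⟩ := hg
  refine ⟨k + n, (analyticAt_clm_comp hk hn).congr (Eventually.of_forall fun ζ => ?_)⟩
  ext x
  simp [smul_smul, pow_add, mul_comm]

end Meromorphic

section DividedDifference

open Polynomial

/-- The divided difference `(q(a) - q(b)) / (a - b)` of a polynomial `q` at two commuting elements
of an algebra, written out as a polynomial in `a` and `b`. -/
def dividedDifference {R A : Type*} [CommRing R] [Ring A] [Algebra R A] (q : R[X]) (a b : A) : A :=
  ∑ n ∈ q.support, q.coeff n • ∑ i ∈ Finset.range n, a ^ i * b ^ (n - 1 - i)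

theorem sub_mul_dividedDifference {R A : Type*} [CommRing R] [Ring A] [Algebra R A] (q : R[X])
    {a b : A} (h : Commute a b) : (a - b) * dividedDifference q a b = aeval a q - aeval b q := by
  simp only [dividedDifference, Finset.mul_sum (s := q.support), mul_smul_comm, h.mul_geom_sum₂,
    aeval_def, eval₂_eq_sum, Polynomial.sum_def, ← Algebra.smul_def, smul_sub,
    Finset.sum_sub_distrib]

variable {A : Type*} [NormedRing A] [NormedAlgebra ℂ A]

theorem analyticAt_dividedDifference_algebraMap (q : ℂ[X]) (a : A) (z₀ : ℂ) :
    AnalyticAt ℂ (fun z => dividedDifference q a (algebraMap ℂ A z)) z₀ := by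
  have h : AnalyticAt ℂ (algebraMap ℂ A) z₀ := (algebraMapCLM ℂ A).analyticAt z₀
  unfold dividedDifference
  fun_prop

theorem eventually_eval_ne_zero {q : ℂ[X]} (hq : q ≠ 0) (z₀ : ℂ) :
    ∀ᶠ z in 𝓝[≠] z₀, q.eval z ≠ 0 := by
  filter_upwards [nhdsNE_of_nhdsNE_sdiff_finite univ_mem (q.rootSet_finite ℂ)] with z hz h
  exact hz.2 ((mem_rootSet_of_ne hq).2 (by simpa using h))

theorem isUnit_sub_algebraMap_of_aeval_eq_zero {K B : Type*} [Field K] [Ring B] [Algebra K B]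
    {q : K[X]} {b : B} (hq : aeval b q = 0) {z : K} (hz : q.eval z ≠ 0) :
    IsUnit (b - algebraMap K B z) := by
  rw [IsUnit.sub_iff]
  refine spectrum.notMem_iff.1 fun hspec => ?_
  have h0 : q.eval z ∈ spectrum K (aeval b q) :=
    spectrum.subset_polynomial_aeval b q ⟨z, hspec, rfl⟩
  rw [hq] at h0
  rw [spectrum.mem_iff, sub_zero] at h0
  exact h0 ((IsUnit.mk0 _ hz).map (algebraMap K B))

/-- Where `q a = 0 ≠ q z`, the inverse is a scalar multiple of a divided difference of `q`. -/
theorem meromorphicAt_inverse_sub_algebraMap {a : A} (ha : IsIntegral ℂ a) (z₀ : ℂ) :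
    MeromorphicAt (fun z => Ring.inverse (a - algebraMap ℂ A z)) z₀ := by
  obtain ⟨q, hq, hqa⟩ := ha
  have hscalar : MeromorphicAt (fun z => (-q.eval z)⁻¹) z₀ :=
    (AnalyticAt.aeval_polynomial analyticAt_id q).neg.meromorphicAt.inv
  refine (hscalar.smul (analyticAt_dividedDifference_algebraMap q a z₀).meromorphicAt).congr ?_
  filter_upwards [eventually_eval_ne_zero hq.ne_zero z₀] with z hz
  have hmul : (a - algebraMap ℂ A z) * dividedDifference q a (algebraMap ℂ A z) =
      algebraMap ℂ A (-q.eval z) := by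
    rw [sub_mul_dividedDifference q (Algebra.commutes z a).symm, show aeval a q = 0 from hqa,
      aeval_algebraMap_apply_eq_algebraMap_eval, zero_sub, map_neg]
  have hunit := isUnit_sub_algebraMap_of_aeval_eq_zero hqa hz
  symm
  rw [← mul_one (Ring.inverse _), Ring.inverse_mul_eq_iff_eq_mul _ _ _ hunit, Pi.smul_apply',
    mul_smul_comm, hmul, Algebra.smul_def, ← map_mul, inv_mul_cancel₀ (neg_ne_zero.2 hz), map_one]

end DividedDifference

section FiniteRankPolarPart

variable {X Y Z : Type*} [NormedAddCommGroup X] [NormedSpace ℂ X] [NormedAddCommGroup Y]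
  [NormedSpace ℂ Y] [NormedAddCommGroup Z] [NormedSpace ℂ Z] {F : ℂ → X →L[ℂ] Y} {z₀ : ℂ}

/-- Near `z₀`, the function `F` is the sum of an analytic function and of a meromorphic function
with values in a fixed finite-dimensional subspace `V`. Compared with finite meromorphy, no Laurent
coefficients occur, so that this notion is stable under multiplication by analytic functions. -/
def HasFiniteRankPolarPartAt (F : ℂ → X →L[ℂ] Y) (z₀ : ℂ) : Prop :=
  ∃ (V : Submodule ℂ Y) (m : ℂ → X →L[ℂ] V) (Q : ℂ → X →L[ℂ] Y), FiniteDimensional ℂ V ∧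
    MeromorphicAt m z₀ ∧ AnalyticAt ℂ Q z₀ ∧ ∀ᶠ z in 𝓝[≠] z₀, F z = V.subtypeL ∘L m z + Q z

namespace HasFiniteRankPolarPartAt

theorem of_analyticAt (hF : AnalyticAt ℂ F z₀) : HasFiniteRankPolarPartAt F z₀ :=
  ⟨⊥, 0, F, inferInstance, MeromorphicAt.const 0 z₀, hF, Eventually.of_forall fun z => by simp⟩

theorem congr {F' : ℂ → X →L[ℂ] Y} (hF : HasFiniteRankPolarPartAt F z₀) (h : F =ᶠ[𝓝[≠] z₀] F') :
    HasFiniteRankPolarPartAt F' z₀ := by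
  obtain ⟨V, m, Q, hV, hm, hQ, hFz⟩ := hF
  refine ⟨V, m, Q, hV, hm, hQ, ?_⟩
  filter_upwards [hFz, h] with z hz hz' using hz'.symm.trans hz

theorem add_analyticAt (hF : HasFiniteRankPolarPartAt F z₀) {Q : ℂ → X →L[ℂ] Y}
    (hQ : AnalyticAt ℂ Q z₀) : HasFiniteRankPolarPartAt (fun z => F z + Q z) z₀ := by
  obtain ⟨V, m, Q', hV, hm, hQ', hFz⟩ := hF
  refine ⟨V, m, fun z => Q' z + Q z, hV, hm, hQ'.add hQ, ?_⟩
  filter_upwards [hFz] with z hz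
  rw [hz, add_assoc]

theorem const_comp (hF : HasFiniteRankPolarPartAt F z₀) (K : Y →L[ℂ] Z) :
    HasFiniteRankPolarPartAt (fun z => K ∘L F z) z₀ := by
  obtain ⟨V, m, Q, hV, hm, hQ, hFz⟩ := hF
  refine ⟨(K ∘L V.subtypeL).range, fun z => (K ∘L V.subtypeL).rangeRestrict ∘L m z,
    fun z => K ∘L Q z, inferInstance, meromorphicAt_clm_comp (MeromorphicAt.const _ z₀) hm,
    analyticAt_clm_comp analyticAt_const hQ, ?_⟩
  filter_upwards [hFz] with z hz
  rw [hz, ContinuousLinearMap.comp_add]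
  rfl

theorem comp_analyticAt (hF : HasFiniteRankPolarPartAt F z₀) {ℓ : ℂ → Z →L[ℂ] X}
    (hℓ : AnalyticAt ℂ ℓ z₀) : HasFiniteRankPolarPartAt (fun z => F z ∘L ℓ z) z₀ := by
  obtain ⟨V, m, Q, hV, hm, hQ, hFz⟩ := hF
  refine ⟨V, fun z => m z ∘L ℓ z, fun z => Q z ∘L ℓ z, hV,
    meromorphicAt_clm_comp hm hℓ.meromorphicAt, analyticAt_clm_comp hQ hℓ, ?_⟩
  filter_upwards [hFz] with z hz
  rw [hz, ContinuousLinearMap.add_comp]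
  rfl

theorem meromorphicAt (hF : HasFiniteRankPolarPartAt F z₀) : MeromorphicAt F z₀ := by
  obtain ⟨V, m, Q, -, hm, hQ, hFz⟩ := hF
  have hVm := meromorphicAt_clm_comp (MeromorphicAt.const V.subtypeL z₀) hm
  refine (hVm.add hQ.meromorphicAt).congr ?_
  filter_upwards [hFz] with z hz using hz.symm

end HasFiniteRankPolarPartAt

section Laurent

variable {W : Type*} [NormedAddCommGroup W] [NormedSpace ℂ W] {f : ℂ → W}

theorem exists_hasSum_laurent_of_meromorphicAt (hf : MeromorphicAt f z₀) :
    ∃ (N : ℕ) (c : ℕ → W),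
      ∀ᶠ z in 𝓝[≠] z₀, HasSum (fun n : ℕ => (z - z₀) ^ ((n : ℤ) - (N : ℤ)) • c n) (f z) := by
  obtain ⟨N, p, hp⟩ := hf
  refine ⟨N, p.coeff, ?_⟩
  filter_upwards [nhdsWithin_le_nhds hp.eventually_hasSum_sub, self_mem_nhdsWithin] with z hz hne
  have hne' : z - z₀ ≠ 0 := sub_ne_zero.2 hne
  have h := hz.const_smul ((z - z₀) ^ (N : ℤ))⁻¹
  simpa only [FormalMultilinearSeries.apply_eq_pow_smul_coeff, smul_smul, zpow_natCast, ne_eq,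
    pow_eq_zero_iff', hne', false_and, not_false_eq_true, inv_mul_cancel₀, one_smul,
    zpow_sub₀ hne', div_eq_inv_mul] using h

theorem exists_hasSum_laurent_of_analyticAt (hf : AnalyticAt ℂ f z₀) (N : ℕ) :
    ∃ c : ℕ → W, (∀ n < N, c n = 0) ∧
      ∀ᶠ z in 𝓝[≠] z₀, HasSum (fun n : ℕ => (z - z₀) ^ ((n : ℤ) - (N : ℤ)) • c n) (f z) := by
  obtain ⟨p, hp⟩ := hf
  refine ⟨fun n => if N ≤ n then p.coeff (n - N) else 0, fun n hn => if_neg hn.not_ge, ?_⟩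
  filter_upwards [nhdsWithin_le_nhds hp.eventually_hasSum_sub] with z hz
  refine ((add_left_injective N).hasSum_iff fun n hn => ?_).1 (hz.congr_fun fun n => ?_)
  · rw [if_neg fun h => hn ⟨n - N, Nat.sub_add_cancel h⟩, smul_zero]
  · simp

end Laurent

theorem HasFiniteRankPolarPartAt.finitelyMeromorphicAt {E : Type*} [NormedAddCommGroup E]
    [InnerProductSpace ℂ E] {F : ℂ → E →L[ℂ] E} (hF : HasFiniteRankPolarPartAt F z₀) :
    FinitelyMeromorphicAt F z₀ := by
  obtain ⟨V, m, Q, hV, hm, hQ, hFz⟩ := hF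
  obtain ⟨N, a, ha⟩ := exists_hasSum_laurent_of_meromorphicAt hm
  obtain ⟨b, hb0, hb⟩ := exists_hasSum_laurent_of_analyticAt hQ N
  obtain ⟨ε, hε, hball⟩ := Metric.eventually_nhds_iff_ball.1
    (eventually_nhdsWithin_iff.1 (ha.and (hb.and hFz)))
  refine ⟨ε, hε, N, fun n => V.subtypeL ∘L a n + b n, fun n hn => ?_, fun z ⟨hzε, hz⟩ => ?_⟩
  · beta_reduce
    rw [hb0 n hn, add_zero]
    refine Submodule.finiteDimensional_of_le (S₂ := V) ?_
    rintro _ ⟨x, rfl⟩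
    exact (a n x).2
  · obtain ⟨haz, hbz, hz⟩ := hball z hzε hz
    have h := (haz.mapL (ContinuousLinearMap.compL ℂ E V E V.subtypeL)).add hbz
    simpa only [hz, map_smul, smul_add, ContinuousLinearMap.compL_apply] using h

end FiniteRankPolarPart

section PolarPartResolvent

variable {E : Type*} [NormedAddCommGroup E] [InnerProductSpace ℂ E]
  {T : E →ₗ.[ℂ] E} {z₀ : ℂ}

theorem meromorphicAt_rangeRestrict_comp_resolvent {P : E →L[ℂ] E} (hP : IsFiniteRank P)
    (hT : ∀ᶠ z in 𝓝[≠] z₀, z ∈ resolventSet T)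
    (hcomm : ∀ z ∈ resolventSet T, Commute P (resolvent T z)) :
    MeromorphicAt (fun z => P.rangeRestrict ∘L resolvent T z) z₀ := by
  have : FiniteDimensional ℂ P.range := hP
  obtain ⟨w, hw⟩ := hT.exists
  have hV : ∀ x ∈ P.range, resolvent T w x ∈ P.range := by
    rintro _ ⟨x, rfl⟩
    exact ⟨resolvent T w x, DFunLike.congr_fun (hcomm w hw).eq x⟩
  obtain ⟨D, hD⟩ := exists_forall_mem_graph_of_mapsTo_resolvent hw hV
  have hm := meromorphicAt_inverse_sub_algebraMap (a := D) (Algebra.IsIntegral.isIntegral D) z₀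
  refine (meromorphicAt_clm_comp hm (MeromorphicAt.const P.rangeRestrict z₀)).congr ?_
  filter_upwards [hT] with z hz
  ext x
  calc _ = resolvent T z (P x) :=
        (DFunLike.congr_fun (resolvent_comp_subtypeL hD hz) (P.rangeRestrict x)).symm
    _ = P (resolvent T z x) := (DFunLike.congr_fun (hcomm z hz).eq x).symm

theorem hasFiniteRankPolarPartAt_resolvent [CompleteSpace E]
    (hz₀ : z₀ ∈ discreteSpectrum T ∪ resolventSet T) :
    HasFiniteRankPolarPartAt (resolvent T) z₀ := by
  have hev := eventually_mem_resolventSet hz₀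
  rcases hz₀ with ⟨-, r, hr, hT, hP⟩ | hz₀
  · have hsphere := (sphere_subset_closedBall_sdiff_center hr).trans hT
    have hcauchy := hasFPowerSeriesOn_cauchy_integral (R := ⟨r, hr.le⟩)
      ((continuousOn_resolvent_sphere hsphere).circleIntegrable hr.le) hr
    refine ⟨_, _, _, hP, meromorphicAt_rangeRestrict_comp_resolvent hP hev fun z hz =>
      commute_rieszProjection_resolvent hr.le hsphere hz, hcauchy.analyticAt, ?_⟩
    filter_upwards [hev, nhdsWithin_le_nhds (Metric.ball_mem_nhds z₀ hr)] with z hz hzr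
    rw [add_comm]
    exact resolvent_eq_cauchy_add_riesz hsphere hzr hz
  · exact .of_analyticAt (analyticAt_resolvent hz₀)

end PolarPartResolvent

section BoundedMaps

variable {X G : Type*} [NormedAddCommGroup X] [CompleteSpace X] [NormedAddCommGroup G]
  [CompleteSpace G]

theorem continuous_of_forall_continuous_inner [NormedSpace ℂ X] [InnerProductSpace ℂ G]
    (f : X →ₗ[ℂ] G) (h : ∀ u : G, Continuous fun x => inner ℂ u (f x)) :
    Continuous f := by
  refine f.continuous_of_seq_closed_graph fun s x y hs hfs => ext_inner_left ℂ fun u => ?_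
  exact tendsto_nhds_unique (tendsto_const_nhds.inner hfs) (((h u).tendsto x).comp hs)

theorem hasRightInverse_of_surjective [InnerProductSpace ℂ X] [NormedSpace ℂ G] {L : X →L[ℂ] G}
    (hL : Function.Surjective L) : L.HasRightInverse := by
  have : CompleteSpace L.ker := L.isClosed_ker.completeSpace_coe
  have hrange : L.ker.orthogonalProjectionOnto.range = ⊤ := LinearMap.range_eq_top.2 fun x =>
    ⟨x, L.ker.orthogonalProjectionOnto_mem_subspace_eq_self x⟩
  have hcompl : IsCompl L.ker L.ker.orthogonalProjectionOnto.ker := by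
    rw [Submodule.ker_orthogonalProjectionOnto]
    exact L.ker.isCompl_orthogonal
  let e := L.equivProdOfSurjectiveOfIsCompl _ (LinearMap.range_eq_top.2 hL) hrange hcompl
  exact ⟨(e.symm : G × L.ker →L[ℂ] X) ∘L ContinuousLinearMap.inl ℂ G L.ker, fun y =>
    congrArg Prod.fst (e.apply_symm_apply (y, 0))⟩

end BoundedMaps

section ResolventLift

variable {H : Type*} [NormedAddCommGroup H] [InnerProductSpace ℂ H] {T : H →ₗ.[ℂ] H}
  {N : Submodule ℂ T.domain} {z w : ℂ}

theorem mem_eigenKer {f : T.domain} : f ∈ eigenKer T z ↔ T f = z • (f : H) :=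
  sub_eq_zero

theorem mem_graph_restrict {x y : H} :
    (x, y) ∈ (restrict T N).graph ↔ ∃ f ∈ N, (f : H) = x ∧ T f = y := by
  constructor
  · intro h
    obtain ⟨⟨x', ⟨f, hf, hfx⟩, h2⟩, rfl, rfl⟩ := (LinearPMap.mem_graph_iff _).1 h
    exact ⟨f, hf, hfx, (LinearPMap.domRestrict_apply hfx.symm).symm⟩
  · rintro ⟨f, hf, rfl, rfl⟩
    refine (LinearPMap.mem_graph_iff _).2 ⟨⟨f, ⟨f, hf, rfl⟩, f.2⟩, rfl, ?_⟩
    exact LinearPMap.domRestrict_apply rfl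

/-- The resolvent `(T ↾ N - z)⁻¹` of a restriction of `T`, as a map into `dom T`: the operations
defined on `dom T`, such as boundary maps, can be applied to its values. -/
noncomputable def resolventLift (hz : z ∈ resolventSet (restrict T N)) : H →ₗ[ℂ] T.domain :=
  (resolvent (restrict T N) z : H →ₗ[ℂ] H).codRestrict T.domain fun y =>
    (LinearPMap.mem_domain_of_mem_graph (resolvent_mem_graph hz y)).2

theorem coe_resolventLift (hz : z ∈ resolventSet (restrict T N)) (y : H) :
    (resolventLift hz y : H) = resolvent (restrict T N) z y := rfl

theorem resolventLift_eq_iff (hz : z ∈ resolventSet (restrict T N)) {f : T.domain} {y : H} :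
    resolventLift hz y = f ↔ f ∈ N ∧ T f - z • (f : H) = y := by
  rw [Subtype.ext_iff, coe_resolventLift, resolvent_apply_eq_iff hz, mem_graph_restrict]
  constructor
  · rintro ⟨g, hg, hgf, hgy⟩
    obtain rfl : g = f := Subtype.ext hgf
    exact ⟨hg, sub_eq_of_eq_add hgy⟩
  · rintro ⟨hf, rfl⟩
    exact ⟨f, hf, rfl, (sub_add_cancel _ _).symm⟩

theorem resolventLift_mem (hz : z ∈ resolventSet (restrict T N)) (y : H) : resolventLift hz y ∈ N :=
  ((resolventLift_eq_iff hz).1 rfl).1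

theorem apply_resolventLift (hz : z ∈ resolventSet (restrict T N)) (y : H) :
    T (resolventLift hz y) = y + z • resolvent (restrict T N) z y :=
  sub_eq_iff_eq_add.1 ((resolventLift_eq_iff hz).1 rfl).2

theorem resolventLift_apply_add_smul (hz : z ∈ resolventSet (restrict T N))
    (hw : w ∈ resolventSet (restrict T N)) (y : H) :
    resolventLift hw (y + (z - w) • resolvent (restrict T N) z y) = resolventLift hz y :=
  Subtype.ext (resolvent_apply_add_smul hz hw y)

theorem continuous_apply_resolventLift (hz : z ∈ resolventSet (restrict T N)) :
    Continuous fun y => T (resolventLift hz y) := by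
  simp only [apply_resolventLift]
  fun_prop

end ResolventLift

namespace BoundaryTriple

variable {H : Type*} [NormedAddCommGroup H] [InnerProductSpace ℂ H] [CompleteSpace H]
  {S : H →ₗ.[ℂ] H} {G : Type*} [NormedAddCommGroup G] [InnerProductSpace ℂ G]
  (bt : BoundaryTriple S G) {z w : ℂ}

theorem eq_zero_of_mem_eigenKer (hz : z ∈ resolventSet bt.baseExtension) {f : S†.domain}
    (hf : f ∈ eigenKer S† z) (h0 : bt.Γ₀ f = 0) : f = 0 := by
  have h : resolventLift hz 0 = f :=
    (resolventLift_eq_iff hz).2 ⟨h0, sub_eq_zero.2 (mem_eigenKer.1 hf)⟩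
  rw [← h, map_zero]

theorem mem_graph_gammaField (hz : z ∈ resolventSet bt.baseExtension) {x : G} {f : S†.domain} :
    (x, f) ∈ (bt.gammaField z).graph ↔ f ∈ eigenKer S† z ∧ bt.Γ₀ f = x := by
  have hker : LinearMap.ker (bt.Γ₀.toPMap (eigenKer S† z)).toFun = ⊥ :=
    LinearMap.ker_eq_bot'.2 fun f hf => Subtype.ext (bt.eq_zero_of_mem_eigenKer hz f.2 hf)
  rw [gammaField, LinearPMap.inverse_graph hker]
  constructor
  · rintro ⟨⟨a, b⟩, hab, h⟩
    obtain ⟨g, rfl, rfl⟩ := (LinearPMap.mem_graph_iff _).1 hab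
    obtain ⟨rfl, rfl⟩ := Prod.mk.inj h
    exact ⟨g.2, rfl⟩
  · rintro ⟨hf, rfl⟩
    exact ⟨(f, bt.Γ₀ f), (bt.Γ₀.toPMap (eigenKer S† z)).mem_graph ⟨f, hf⟩, rfl⟩

theorem mem_graph_weylM (hz : z ∈ resolventSet bt.baseExtension) {x y : G} :
    (x, y) ∈ (bt.weylM z).graph ↔ ∃ f ∈ eigenKer S† z, bt.Γ₀ f = x ∧ bt.Γ₁ f = y := by
  constructor
  · intro h
    obtain ⟨x', rfl, rfl⟩ := (LinearPMap.mem_graph_iff _).1 h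
    obtain ⟨hf, hΓ₀⟩ := (bt.mem_graph_gammaField hz).1 ((bt.gammaField z).mem_graph x')
    exact ⟨_, hf, hΓ₀, rfl⟩
  · rintro ⟨f, hf, hx, rfl⟩
    obtain ⟨x', rfl, rfl⟩ :=
      (LinearPMap.mem_graph_iff _).1 ((bt.mem_graph_gammaField hz).2 ⟨hf, hx⟩)
    exact (bt.weylM z).mem_graph x'

theorem mem_graph_sub_weylM_iff (hz : z ∈ resolventSet bt.baseExtension) {Θ : G →ₗ.[ℂ] G}
    {e : S†.domain} (he : bt.Γ₀ e = 0) {x : G} :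
    (x, bt.Γ₁ e) ∈ (Θ - bt.weylM z).graph ↔ ∃ f : S†.domain, (bt.Γ₀ f, bt.Γ₁ f) ∈ Θ.graph ∧
      bt.Γ₀ f = x ∧ S† f - z • (f : H) = S† e - z • (e : H) := by
  have hdiff : ∀ f g : S†.domain, f - g ∈ eigenKer S† z ↔
      S† f - z • (f : H) = S† g - z • (g : H) := fun f g => by
    rw [eigenKer, LinearMap.sub_mem_ker_iff]
    rfl
  rw [mem_graph_sub_iff]
  constructor
  · rintro ⟨a, b, ha, hb, hab⟩
    obtain ⟨g, hg, rfl, rfl⟩ := (bt.mem_graph_weylM hz).1 hb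
    refine ⟨g + e, ?_, by rw [map_add, he, add_zero], (hdiff _ _).1 (by rwa [add_sub_cancel_right])⟩
    rwa [map_add, map_add, he, add_zero, ← hab, add_sub_cancel]
  · rintro ⟨f, hf, rfl, hfe⟩
    refine ⟨_, _, hf, (bt.mem_graph_weylM hz).2 ⟨f - e, (hdiff _ _).2 hfe, ?_, rfl⟩, ?_⟩
    · rw [map_sub, he, sub_zero]
    · rw [map_sub, sub_sub_cancel]

theorem mem_graph_sub_weylM_iff_resolventLift (hzA : z ∈ resolventSet bt.baseExtension)
    {Θ : G →ₗ.[ℂ] G} (hzB : z ∈ resolventSet (bt.extension Θ)) {e : S†.domain}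
    (he : bt.Γ₀ e = 0) {x : G} :
    (x, bt.Γ₁ e) ∈ (Θ - bt.weylM z).graph ↔
      bt.Γ₀ (resolventLift hzB (S† e - z • (e : H))) = x := by
  rw [bt.mem_graph_sub_weylM_iff hzA he]
  constructor
  · rintro ⟨f, hf, rfl, hfe⟩
    rw [(resolventLift_eq_iff hzB).2 ⟨hf, hfe⟩]
  · intro hx
    obtain ⟨hf, hfe⟩ := (resolventLift_eq_iff hzB).1 rfl
    exact ⟨_, hf, hx, hfe⟩

section Continuity

variable [CompleteSpace G] {X : Type*} [NormedAddCommGroup X] [NormedSpace ℂ X] [CompleteSpace X]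

theorem continuous_Γ₀_comp (L : X →ₗ[ℂ] S†.domain) (hL : Continuous fun x => (L x : H))
    (hSL : Continuous fun x => S† (L x)) : Continuous (bt.Γ₀ ∘ₗ L) := by
  refine continuous_of_forall_continuous_inner _ fun u => ?_
  obtain ⟨g, hg⟩ := bt.surjective (0, -u)
  obtain ⟨h0, h1⟩ := Prod.mk.inj hg
  have hgreen : ∀ x, inner ℂ u (bt.Γ₀ (L x)) =
      inner ℂ (g : H) (S† (L x)) - inner ℂ (S† g) (L x : H) := fun x => by
    rw [bt.green, h0, h1, inner_zero_left, inner_neg_left, zero_sub, neg_neg]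
  simp only [LinearMap.comp_apply, hgreen]
  fun_prop

theorem continuous_Γ₁_comp (L : X →ₗ[ℂ] S†.domain) (hL : Continuous fun x => (L x : H))
    (hSL : Continuous fun x => S† (L x)) : Continuous (bt.Γ₁ ∘ₗ L) := by
  refine continuous_of_forall_continuous_inner _ fun u => ?_
  obtain ⟨g, hg⟩ := bt.surjective (u, 0)
  obtain ⟨h0, h1⟩ := Prod.mk.inj hg
  have hgreen : ∀ x, inner ℂ u (bt.Γ₁ (L x)) =
      inner ℂ (g : H) (S† (L x)) - inner ℂ (S† g) (L x : H) := fun x => by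
    rw [bt.green, h0, h1, inner_zero_left, sub_zero]
  simp only [LinearMap.comp_apply, hgreen]
  fun_prop

end Continuity

section Krein

variable [CompleteSpace G] {Θ : G →ₗ.[ℂ] G} {z₀ : ℂ}

theorem exists_clm_lift_Γ₁ (hz : z ∈ resolventSet bt.baseExtension) :
    ∃ E F : G →L[ℂ] H, ∀ y, ∃ e : S†.domain,
      bt.Γ₀ e = 0 ∧ bt.Γ₁ e = y ∧ (e : H) = E y ∧ S† e = F y := by
  let R := resolvent bt.baseExtension z
  let L : H →L[ℂ] G := ⟨bt.Γ₁ ∘ₗ resolventLift hz,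
    bt.continuous_Γ₁_comp _ R.continuous (continuous_apply_resolventLift hz)⟩
  have hL : Function.Surjective L := fun y => by
    obtain ⟨f, hf⟩ := bt.surjective (0, y)
    obtain ⟨h0, h1⟩ := Prod.mk.inj hf
    exact ⟨_, (congrArg bt.Γ₁ ((resolventLift_eq_iff hz).2 ⟨h0, rfl⟩)).trans h1⟩
  obtain ⟨C, hC⟩ := hasRightInverse_of_surjective hL
  exact ⟨R ∘L C, (1 + z • R) ∘L C, fun y => ⟨resolventLift hz (C y), resolventLift_mem hz _, hC y,
    rfl, apply_resolventLift hz _⟩⟩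

theorem exists_isBoundedInverse_sub_weylM (hwA : w ∈ resolventSet bt.baseExtension)
    (hwB : w ∈ resolventSet (bt.extension Θ)) :
    ∃ (K : H →L[ℂ] G) (E F : G →L[ℂ] H), ∀ z ∈ resolventSet bt.baseExtension,
      z ∈ resolventSet (bt.extension Θ) → IsBoundedInverse (Θ - bt.weylM z)
        (K ∘L (1 + (z - w) • resolvent (bt.extension Θ) z) ∘L (F - z • E)) := by
  let K : H →L[ℂ] G := ⟨bt.Γ₀ ∘ₗ resolventLift hwB,
    bt.continuous_Γ₀_comp _ (resolvent (bt.extension Θ) w).continuous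
      (continuous_apply_resolventLift hwB)⟩
  obtain ⟨E, F, hEF⟩ := bt.exists_clm_lift_Γ₁ hwA
  refine ⟨K, E, F, fun z hzA hzB x y => ?_⟩
  obtain ⟨e, h0, rfl, hE, hF⟩ := hEF y
  have hK : K ((1 + (z - w) • resolvent (bt.extension Θ) z) (S† e - z • (e : H))) =
      bt.Γ₀ (resolventLift hzB (S† e - z • (e : H))) :=
    congrArg bt.Γ₀ (resolventLift_apply_add_smul hzB hwB _)
  rw [bt.mem_graph_sub_weylM_iff_resolventLift hzA hzB h0, ← hK, hE, hF]
  rfl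

theorem boundedlyInvertible_sub_weylM (hzA : z ∈ resolventSet bt.baseExtension)
    (hzB : z ∈ resolventSet (bt.extension Θ)) : BoundedlyInvertible (Θ - bt.weylM z) := by
  obtain ⟨K, E, F, hKEF⟩ := bt.exists_isBoundedInverse_sub_weylM hzA hzB
  exact ⟨_, hKEF z hzA hzB⟩

theorem hasFiniteRankPolarPartAt_boundedInverse_sub_weylM
    (hA : ∀ᶠ z in 𝓝[≠] z₀, z ∈ resolventSet bt.baseExtension)
    (hB : z₀ ∈ discreteSpectrum (bt.extension Θ) ∪ resolventSet (bt.extension Θ)) :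
    HasFiniteRankPolarPartAt (fun z => boundedInverse (Θ - bt.weylM z)) z₀ := by
  have hAB := hA.and (eventually_mem_resolventSet hB)
  obtain ⟨w, hwA, hwB⟩ := hAB.exists
  obtain ⟨K, E, F, hKEF⟩ := bt.exists_isBoundedInverse_sub_weylM hwA hwB
  have hℓ : AnalyticAt ℂ (fun z => F - z • E) z₀ := by fun_prop
  have hℓ' : AnalyticAt ℂ (fun z => (z - w) • (F - z • E)) z₀ := by fun_prop
  refine ((((hasFiniteRankPolarPartAt_resolvent hB).comp_analyticAt hℓ').add_analyticAt
    hℓ).const_comp K).congr ?_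
  filter_upwards [hAB] with z ⟨hzA, hzB⟩
  rw [(hKEF z hzA hzB).boundedInverse_eq, ContinuousLinearMap.comp_smul,
    ← ContinuousLinearMap.smul_comp, add_comm, ContinuousLinearMap.add_comp]
  rfl

theorem analyticAt_boundedInverse_sub_weylM (hA : z₀ ∈ resolventSet bt.baseExtension)
    (hB : z₀ ∈ resolventSet (bt.extension Θ)) :
    AnalyticAt ℂ (fun z => boundedInverse (Θ - bt.weylM z)) z₀ := by
  obtain ⟨K, E, F, hKEF⟩ := bt.exists_isBoundedInverse_sub_weylM hA hB
  have hR := analyticAt_resolvent hB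
  have hℓ : AnalyticAt ℂ (fun z => F - z • E) z₀ := by fun_prop
  have hmid : AnalyticAt ℂ (fun z => 1 + (z - z₀) • resolvent (bt.extension Θ) z) z₀ := by fun_prop
  refine (analyticAt_clm_comp (analyticAt_const (v := K)) (analyticAt_clm_comp hmid hℓ)).congr ?_
  filter_upwards [(isOpen_resolventSet _).mem_nhds hA, (isOpen_resolventSet _).mem_nhds hB]
    with z hzA hzB using (hKEF z hzA hzB).boundedInverse_eq.symm

end Krein

end BoundaryTriple

end WeylExt

theorem proposition4p7_general
    {H : Type*} [NormedAddCommGroup H] [InnerProductSpace ℂ H] [CompleteSpace H]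
    {G : Type*} [NormedAddCommGroup G] [InnerProductSpace ℂ G] [CompleteSpace G]
    {ι : Type*} [Finite ι] {S : H →ₗ.[ℂ] H} (_hS : Dense (S.domain : Set H))
    (bt : WeylExt.BoundaryTriple S G) (Θ : ι → G →ₗ.[ℂ] G) {z₀ : ℂ}
    (hA : ∀ᶠ z in 𝓝[≠] z₀, z ∈ WeylExt.resolventSet bt.baseExtension)
    (hB : ∀ j, z₀ ∈ WeylExt.discreteSpectrum (bt.extension (Θ j)) ∪
      WeylExt.resolventSet (bt.extension (Θ j))) :
    ∃ ε₀ : ℝ, 0 < ε₀ ∧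
      Metric.ball z₀ ε₀ \ {z₀} ⊆ WeylExt.resolventSet bt.baseExtension ∧
      ∀ j,
        (∀ z ∈ Metric.ball z₀ ε₀ \ {z₀}, WeylExt.BoundedlyInvertible (Θ j - bt.weylM z)) ∧
        AnalyticOnNhd ℂ (fun z => WeylExt.boundedInverse (Θ j - bt.weylM z))
          (Metric.ball z₀ ε₀ \ {z₀}) ∧
        WeylExt.FinitelyMeromorphicOn (fun z => WeylExt.boundedInverse (Θ j - bt.weylM z))
          (Metric.ball z₀ ε₀) := by
  obtain ⟨ε₀, hε₀, hball⟩ := Metric.eventually_nhds_iff_ball.1 <| eventually_nhdsWithin_iff.1 <|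
    hA.and (eventually_all.2 fun j => WeylExt.eventually_mem_resolventSet (hB j))
  have hpolar := fun j => bt.hasFiniteRankPolarPartAt_boundedInverse_sub_weylM hA (hB j)
  have hanalytic : ∀ j, ∀ z ∈ Metric.ball z₀ ε₀ \ {z₀},
      AnalyticAt ℂ (fun z => WeylExt.boundedInverse (Θ j - bt.weylM z)) z := fun j z hz =>
    have ⟨hzA, hzB⟩ := hball z hz.1 hz.2
    bt.analyticAt_boundedInverse_sub_weylM hzA (hzB j)
  refine ⟨ε₀, hε₀, fun z hz => (hball z hz.1 hz.2).1, fun j => ⟨fun z hz => ?_, hanalytic j,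
    fun z hz => ?_, fun z hz hneg => ?_⟩⟩
  · exact bt.boundedlyInvertible_sub_weylM (hball z hz.1 hz.2).1 ((hball z hz.1 hz.2).2 j)
  · rcases eq_or_ne z z₀ with rfl | hne
    · exact (hpolar j).meromorphicAt
    · exact (hanalytic j z ⟨hz, hne⟩).meromorphicAt
  · rcases eq_or_ne z z₀ with rfl | hne
    · exact (hpolar j).finitelyMeromorphicAt
    · exact absurd hneg (hanalytic j z ⟨hz, hne⟩).meromorphicOrderAt_nonneg.not_gt

theorem proposition4p7
    {H : Type*} [NormedAddCommGroup H] [InnerProductSpace ℂ H] [CompleteSpace H]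
    [TopologicalSpace.SeparableSpace H]
    {G : Type*} [NormedAddCommGroup G] [InnerProductSpace ℂ G] [CompleteSpace G]
    (B : Fin 2 → H →ₗ.[ℂ] H) (S A₀ : H →ₗ.[ℂ] H)
    (hset : WeylExt.Setting B S A₀)
    (bt : WeylExt.BoundaryTriple S G)
    (hA₀ : A₀ = bt.baseExtension)
    (Θ : Fin 2 → G →ₗ.[ℂ] G)
    (hΘ_dense : ∀ j, Dense ((Θ j).domain : Set G))
    (hΘ_closed : ∀ j, (Θ j).IsClosed)
    (hB : ∀ j, B j = bt.extension (Θ j))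
    (hB_adjoint : ∀ j, (B j).adjoint = bt.extension (Θ j).adjoint)
    (z₀ : ℂ)
    (hz₀_B : ∀ j, z₀ ∈ WeylExt.discreteSpectrum (B j) ∪ WeylExt.resolventSet (B j))
    (hz₀_A₀ : z₀ ∈ WeylExt.discreteSpectrum A₀ ∪ WeylExt.resolventSet A₀) :
    ∃ ε₀ : ℝ, 0 < ε₀ ∧
      Metric.ball z₀ ε₀ \ {z₀} ⊆ WeylExt.resolventSet A₀ ∧
      ∀ j,
        (∀ z ∈ Metric.ball z₀ ε₀ \ {z₀}, WeylExt.BoundedlyInvertible (Θ j - bt.weylM z)) ∧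
        AnalyticOnNhd ℂ (fun z => WeylExt.boundedInverse (Θ j - bt.weylM z))
          (Metric.ball z₀ ε₀ \ {z₀}) ∧
        WeylExt.FinitelyMeromorphicOn (fun z => WeylExt.boundedInverse (Θ j - bt.weylM z))
          (Metric.ball z₀ ε₀) := by
  subst hA₀
  obtain rfl : B = fun j => bt.extension (Θ j) := funext hB
  exact proposition4p7_general hset.dense_S bt Θ (WeylExt.eventually_mem_resolventSet hz₀_A₀) hz₀_B
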